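/- Let $\mathbb D$ be the space of right-continuous functions $x:[0,1]\to\mathbb R$ with left limits, with $\|x\|=\sup_{s\in[0,1]}|x(s)|$. Let $\Lambda$ be the set of strictly increasing continuous functions from $[0,1]$ onto $[0,1]$, let $e$ be the identity of $[0,1]$, and for $\lambda\in\Lambda$ put $\|\lambda\|^0=\sup_{s<s'}\left|\log\frac{\lambda(s')-\lambda(s)}{s'-s}\right|$. Equip $\mathbb D$ with the Skorohod distance $$d^0_{J_1}(x,y)=\inf_{\lambda\in\Lambda}\{\|\lambda\|^0\vee\|x-y\circ\lambda\|\},$$ which induces the $J_1$-topology. Let $\mathbb D([0,1];\mathbb D)$ be the set of functions $x:[0,1]\to\mathbb D$ that are right-continuous and have left limits with respect to $J_1$; write $x(t)=\{x(t,s)\}_{s\in[0,1]}$, let $x(t-)\in\mathbb D$ denote the $J_1$-left limit at $t$, and let $x(t,1-)$ denote the left limit at $1$ of the real function $s\mapsto x(t,s)$. Put $\|x\|_{\mathbb D}=\sup_{t\in[0,1]}\|x(t)\|$ and equip $\mathbb D([0,1];\mathbb D)$ with the distance $$d_{\mathbb D}(x,y)=\inf_{\lambda\in\Lambda}\Big\{\sup_{t\in[0,1]}|\lambda(t)-t|\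 \vee\ \sup_{t\in[0,1]}d^0_{J_1}\big(x(t),y(\lambda(t))\big)\Big\}.$$ For $\delta\in(0,1)$ define, for $x\in\mathbb D$, $$w''(x,\delta)=\sup_{s_1\le s\le s_2,\ s_2-s_1\le\delta}\big(|x(s)-x(s_1)|\wedge|x(s_2)-x(s)|\big),$$ and, for $x\in\mathbb D([0,1];\mathbb D)$, $$w''_{\mathbb D}(x,\delta)=\sup_{t_1\le t\le t_2,\ t_2-t_1\le\delta}\big(d^0_{J_1}(x(t),x(t_1))\wedge d^0_{J_1}(x(t_2),x(t))\big).$$ **Theorem.** A set $A\subset\mathbb D([0,1];\mathbb D)$ is relatively compact with respect to $d_{\mathbb D}$ (that is, its closure is compact) if and only if the following three conditions hold (all limits being taken as $\delta\downarrow0$): (i) $\sup_{x\in A}\|x\|_{\mathbb D}<\infty$; (ii') (a) $\lim_{\delta\to0}\sup_{x\in A}\sup_{t\in[0,1]}w''(x(t),\delta)=0$, (b) $\lim_{\delta\to0}\sup_{x\in A}\sup_{t\in[0,1]}|x(t,\delta)-x(t,0)|=0$, and (c) $\lim_{\delta\to0}\sup_{x\in A}\sup_{t\in[0,1]}|x(t,1-)-x(t,1-\delta)|=0$;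 (iii') (a) $\lim_{\delta\to0}\sup_{x\in A}w''_{\mathbb D}(x,\delta)=0$, (b) $\lim_{\delta\to0}\sup_{x\in A}d^0_{J_1}(x(\delta),x(0))=0$, and (c) $\lim_{\delta\to0}\sup_{x\in A}d^0_{J_1}(x(1-),x(1-\delta))=0$. (The supremum over the empty set is $0$.) -/

import Mathlib

open Set Filter Topology unitInterval
open scoped ENNReal

namespace Skorohod

/-- Functions `[0,1] → S` that are right-continuous and have left limits. -/
structure Cadlag (S : Type*) [TopologicalSpace S] where
  toFun : I → S
  right_continuous' : ∀ t, ContinuousWithinAt toFun (Ici t) t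
  left_limit' : ∀ t, 0 < t → ∃ l : S, Tendsto toFun (𝓝[<] t) (𝓝 l)

instance {S : Type*} [TopologicalSpace S] : CoeFun (Cadlag S) (fun _ => I → S) :=
  ⟨Cadlag.toFun⟩

/-- The class `Λ` of time changes: increasing bijections of `[0,1]`. An increasing bijection of
`[0,1]` is automatically continuous, so these are exactly the strictly increasing continuous
functions from `[0,1]` onto `[0,1]`. -/
abbrev TimeChange := I ≃o I

/-- `‖l‖⁰ = sup_{s < s'} |log ((l s' - l s) / (s' - s))|`, with values in `[0,∞]`. -/
noncomputable def logNorm (l : TimeChange) : ℝ≥0∞ :=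
  ⨆ (s : I) (s' : I) (_ : s < s'),
    ENNReal.ofReal |Real.log (((l s' : ℝ) - (l s : ℝ)) / ((s' : ℝ) - (s : ℝ)))|

/-- `‖l - e‖`, where `e` is the identity of `[0,1]`. -/
noncomputable def supDev (l : TimeChange) : ℝ≥0∞ := ⨆ t : I, edist (l t) t

/-- `sup_t d (x t) (y (l t))`, for functions with values in a metric space `(S, d)`. -/
noncomputable def unifDist {S : Type*} [PseudoEMetricSpace S] (x y : Cadlag S)
    (l : TimeChange) : ℝ≥0∞ :=
  ⨆ t : I, edist (x t) (y (l t))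

theorem logNorm_refl : logNorm (OrderIso.refl I) = 0 := by
  simp only [logNorm, ENNReal.iSup_eq_zero]
  intro s s' h
  have h' : (s' : ℝ) - s ≠ 0 := sub_ne_zero.2 (ne_of_gt h)
  simp [div_self h']

theorem le_logNorm (l : TimeChange) {s s' : I} (h : s < s') :
    ENNReal.ofReal |Real.log (((l s' : ℝ) - (l s : ℝ)) / ((s' : ℝ) - (s : ℝ)))| ≤ logNorm l :=
  le_iSup_of_le s (le_iSup_of_le s' (le_iSup_of_le h le_rfl))

theorem logNorm_symm_le (l : TimeChange) : logNorm l.symm ≤ logNorm l := by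
  refine iSup_le fun s => iSup_le fun s' => iSup_le fun h => ?_
  refine le_trans (le_of_eq ?_) (le_logNorm l (l.symm.lt_iff_lt.2 h))
  rw [l.apply_symm_apply, l.apply_symm_apply, ← inv_div, Real.log_inv, abs_neg]

theorem logNorm_trans_le (l m : TimeChange) : logNorm (l.trans m) ≤ logNorm l + logNorm m := by
  refine iSup_le fun s => iSup_le fun s' => iSup_le fun h => ?_
  have hl : l s < l s' := l.lt_iff_lt.2 h
  have hm : m (l s) < m (l s') := m.lt_iff_lt.2 hl
  refine le_trans ?_ (add_le_add (le_logNorm l h) (le_logNorm m hl))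
  rw [← ENNReal.ofReal_add (abs_nonneg _) (abs_nonneg _)]
  refine ENNReal.ofReal_le_ofReal ?_
  have h1 : (0 : ℝ) < s' - s := sub_pos.2 h
  have h2 : (0 : ℝ) < (l s' : ℝ) - l s := sub_pos.2 hl
  have h3 : (0 : ℝ) < (m (l s') : ℝ) - m (l s) := sub_pos.2 hm
  refine le_trans (le_of_eq ?_) (abs_add_le _ _)
  rw [← Real.log_mul (div_pos h2 h1).ne' (div_pos h3 h2).ne']
  simp only [OrderIso.trans_apply]
  congr 2
  field_simp

theorem supDev_refl : supDev (OrderIso.refl I) = 0 := by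
  simp [supDev]

theorem supDev_symm_le (l : TimeChange) : supDev l.symm ≤ supDev l := by
  refine iSup_le fun t => le_iSup_of_le (l.symm t) ?_
  rw [l.apply_symm_apply, edist_comm]

theorem supDev_trans_le (l m : TimeChange) : supDev (l.trans m) ≤ supDev l + supDev m := by
  refine iSup_le fun t => ?_
  refine (edist_triangle _ (l t) _).trans ?_
  rw [add_comm]
  exact add_le_add (le_iSup (fun t => edist (l t) t) t)
    (le_iSup (fun t => edist (m t) t) (l t))

/-- The Skorohod-type distance `inf_l max (N l) (sup_t d (x t) (y (l t)))` attached to a size `N`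
of time changes. -/
noncomputable def skorohodDist {S : Type*} [PseudoEMetricSpace S] (N : TimeChange → ℝ≥0∞)
    (x y : Cadlag S) : ℝ≥0∞ :=
  ⨅ l : TimeChange, max (N l) (unifDist x y l)

theorem skorohodDist_self {S : Type*} [PseudoEMetricSpace S] {N : TimeChange → ℝ≥0∞}
    (h0 : N (OrderIso.refl I) = 0) (x : Cadlag S) : skorohodDist N x x = 0 := by
  refine le_antisymm (iInf_le_of_le (OrderIso.refl I) ?_) bot_le
  simp [h0, unifDist]

theorem skorohodDist_comm {S : Type*} [PseudoEMetricSpace S] {N : TimeChange → ℝ≥0∞}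
    (hs : ∀ l, N l.symm ≤ N l) (x y : Cadlag S) : skorohodDist N x y = skorohodDist N y x := by
  have key : ∀ x y : Cadlag S, skorohodDist N x y ≤ skorohodDist N y x := by
    intro x y
    refine le_iInf fun l => iInf_le_of_le l.symm (max_le_max (hs l) ?_)
    refine iSup_le fun t => le_iSup_of_le (l.symm t) ?_
    rw [l.apply_symm_apply, edist_comm]
  exact le_antisymm (key x y) (key y x)

theorem skorohodDist_triangle {S : Type*} [PseudoEMetricSpace S] {N : TimeChange → ℝ≥0∞}
    (ht : ∀ l m : TimeChange, N (l.trans m) ≤ N l + N m) (x y z : Cadlag S) :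
    skorohodDist N x z ≤ skorohodDist N x y + skorohodDist N y z := by
  refine ENNReal.le_iInf_add_iInf fun l m => ?_
  refine iInf_le_of_le (l.trans m) (max_le ?_ ?_)
  · exact (ht l m).trans (add_le_add (le_max_left _ _) (le_max_left _ _))
  · refine iSup_le fun t => (edist_triangle _ (y (l t)) _).trans (add_le_add ?_ ?_)
    · exact (le_iSup (fun t => edist (x t) (y (l t))) t).trans (le_max_right _ _)
    · exact (le_iSup (fun t => edist (y t) (z (m t))) (l t)).trans (le_max_right _ _)

/-- The space `D` of real càdlàg functions on `[0,1]`. -/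
abbrev D := Cadlag ℝ

/-- `D` carries the distance `d⁰_{J₁}(x,y) = inf_l max ‖l‖⁰ ‖x - y ∘ l‖`, and its topology, the
`J₁`-topology. (It separates points and is finite; that is not needed to set up the topology.) -/
noncomputable instance : PseudoEMetricSpace D where
  edist := skorohodDist logNorm
  edist_self := skorohodDist_self logNorm_refl
  edist_comm := skorohodDist_comm logNorm_symm_le
  edist_triangle := skorohodDist_triangle logNorm_trans_le

/-- The space `D([0,1];D)` of functions `[0,1] → D` that are right-continuous and have left limits
with respect to `J₁`. -/
abbrev DD := Cadlag D

/-- `D([0,1];D)` carries the distance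
`d_D(x,y) = inf_l max ‖l - e‖ (sup_t d⁰_{J₁}(x(t), y(l(t))))`, and its topology. -/
noncomputable instance : PseudoEMetricSpace DD where
  edist := skorohodDist supDev
  edist_self := skorohodDist_self supDev_refl
  edist_comm := skorohodDist_comm supDev_symm_le
  edist_triangle := skorohodDist_triangle supDev_trans_le

/-- The super-uniform norm `‖x‖_D = sup_t sup_s |x(t,s)|`. -/
noncomputable def superNorm (x : DD) : ℝ≥0∞ := ⨆ (t : I) (s : I), ‖x t s‖ₑ

/-- The modulus `sup {min (d(x(s),x(s₁))) (d(x(s₂),x(s))) : s₁ ≤ s ≤ s₂, s₂ - s₁ ≤ δ}`. With `S = ℝ`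
it is `w''(x,δ)`; with `S = D` (and `d = d⁰_{J₁}`) it is `w''_D(x,δ)`. -/
noncomputable def wSecond {S : Type*} [PseudoEMetricSpace S] (x : Cadlag S) (δ : ℝ) : ℝ≥0∞ :=
  ⨆ (s₁ : I) (s : I) (s₂ : I) (_ : s₁ ≤ s ∧ s ≤ s₂ ∧ (s₂ : ℝ) - (s₁ : ℝ) ≤ δ),
    min (edist (x s) (x s₁)) (edist (x s₂) (x s))

end Skorohod

namespace Skorohod

open scoped NNReal

/-! ### Time changes -/

theorem logNorm_le_ofReal_iff {l : TimeChange} {c : ℝ} (hc : 0 ≤ c) :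
    logNorm l ≤ ENNReal.ofReal c ↔ ∀ s s' : I, s ≤ s' →
      Real.exp (-c) * ((s' : ℝ) - s) ≤ (l s' : ℝ) - l s ∧
        (l s' : ℝ) - l s ≤ Real.exp c * ((s' : ℝ) - s) := by
  have key : ∀ s s' : I, s < s' →
      (ENNReal.ofReal |Real.log (((l s' : ℝ) - (l s : ℝ)) / ((s' : ℝ) - (s : ℝ)))|
        ≤ ENNReal.ofReal c ↔
      Real.exp (-c) * ((s' : ℝ) - s) ≤ (l s' : ℝ) - l s ∧
        (l s' : ℝ) - l s ≤ Real.exp c * ((s' : ℝ) - s)) := by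
    intro s s' h
    have h1 : (0 : ℝ) < s' - s := sub_pos.2 h
    have h2 : (0 : ℝ) < (l s' : ℝ) - l s := sub_pos.2 (l.lt_iff_lt.2 h)
    rw [ENNReal.ofReal_le_ofReal_iff hc, abs_le, Real.le_log_iff_exp_le (div_pos h2 h1),
      Real.log_le_iff_le_exp (div_pos h2 h1), le_div_iff₀ h1, div_le_iff₀ h1]
  constructor
  · intro h s s' hs
    rcases hs.eq_or_lt with rfl | hs
    · simp
    · exact (key s s' hs).1 ((le_logNorm l hs).trans h)
  · intro h
    exact iSup_le fun s => iSup_le fun s' => iSup_le fun hs => (key s s' hs).2 (h s s' hs.le)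

/-- The lower bound gives strict monotonicity, the upper one continuity, and the intermediate value
theorem surjectivity. Hence limits and sums that keep the two-sided bounds yield time changes. -/
theorem exists_timeChange_of_bilipschitz {g : I → ℝ} {c : ℝ} (hc : 0 ≤ c) (h0 : g 0 = 0)
    (h1 : g 1 = 1) (h : ∀ s s' : I, s ≤ s' →
      Real.exp (-c) * ((s' : ℝ) - s) ≤ g s' - g s ∧ g s' - g s ≤ Real.exp c * ((s' : ℝ) - s)) :
    ∃ l : TimeChange, (∀ t, (l t : ℝ) = g t) ∧ logNorm l ≤ ENNReal.ofReal c := by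
  have hmono : StrictMono g := by
    intro s s' hs
    have h2 : (0 : ℝ) < s' - s := sub_pos.2 hs
    have := (h s s' hs.le).1
    have := mul_pos (Real.exp_pos (-c)) h2
    linarith
  have hmem : ∀ t, g t ∈ I := fun t =>
    ⟨h0 ▸ hmono.monotone t.2.1, h1 ▸ hmono.monotone (show t ≤ 1 from t.2.2)⟩
  have hlip : ∀ s s' : I, dist (g s) (g s') ≤ (Real.exp c).toNNReal * dist s s' := by
    intro s s'
    rw [Real.coe_toNNReal _ (Real.exp_pos c).le]
    wlog hs : s ≤ s' generalizing s s'
    · rw [dist_comm, dist_comm s]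
      exact this s' s (le_of_not_ge hs)
    have h3 : (s : ℝ) ≤ s' := hs
    rw [dist_comm, dist_comm s, Subtype.dist_eq, Real.dist_eq, Real.dist_eq,
      abs_of_nonneg (sub_nonneg.2 (hmono.monotone hs)), abs_of_nonneg (sub_nonneg.2 h3)]
    exact (h s s' hs).2
  have hcont : Continuous g := (LipschitzWith.of_dist_le_mul hlip).continuous
  let G : I → I := fun t => ⟨g t, hmem t⟩
  have hG : StrictMono G := fun s s' hs => hmono hs
  have hsurj : Function.Surjective G := by
    intro y
    have := intermediate_value_univ (0 : I) 1 hcont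
    rw [h0, h1] at this
    obtain ⟨t, ht⟩ := this y.2
    exact ⟨t, Subtype.ext ht⟩
  refine ⟨hG.orderIsoOfSurjective G hsurj, fun t => rfl, ?_⟩
  exact (logNorm_le_ofReal_iff hc).2 h

/-- Since `l 0 = 0`, the bounds on increments from `0` give `e^{-c} t ≤ l t ≤ e^c t`, and `e^c - 1 ≤
2c` for `c ≤ 1`. -/
theorem supDev_le_two_mul_logNorm {l : TimeChange} (h : logNorm l ≤ 1) :
    supDev l ≤ 2 * logNorm l := by
  obtain ⟨c, hc⟩ : ∃ c : ℝ≥0, logNorm l = c :=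
    ⟨_, (ENNReal.coe_toNNReal (ne_top_of_le_ne_top ENNReal.one_ne_top h)).symm⟩
  have hc1 : (c : ℝ) ≤ 1 := by
    rw [hc] at h; exact_mod_cast h
  have hc0 : (0 : ℝ) ≤ c := c.2
  have hb := (logNorm_le_ofReal_iff (l := l) hc0).1 (by rw [hc, ENNReal.ofReal_coe_nnreal])
  refine iSup_le fun t => ?_
  have ht := hb 0 t t.2.1
  have h0 : ((l 0 : I) : ℝ) = 0 := by
    have : l 0 = 0 := l.map_bot
    rw [this]; rfl
  rw [h0] at ht
  simp only [sub_zero, Set.Icc.coe_zero] at ht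
  have h2 := abs_le.1 (Real.abs_exp_sub_one_le (x := c) (by rwa [abs_of_nonneg hc0]))
  rw [abs_of_nonneg hc0] at h2
  have h3 := Real.add_one_le_exp (-(c : ℝ))
  have t0 := t.2.1
  have t1 := t.2.2
  rw [hc, edist_dist, Subtype.dist_eq, Real.dist_eq]
  have : (2 * (c : ℝ≥0∞)) = ENNReal.ofReal (2 * c) := by
    rw [ENNReal.ofReal_mul (by norm_num), ENNReal.ofReal_coe_nnreal]; simp
  rw [this]
  refine ENNReal.ofReal_le_ofReal (abs_le.2 ⟨?_, ?_⟩)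
  · nlinarith
  · nlinarith

/-- The two-sided increment bounds are closed under pointwise limits, so the limit cannot
degenerate. A bound on `supDev` alone would not prevent the limit from having flat pieces or jumps.
-/
theorem exists_timeChange_of_tendsto {l : ℕ → TimeChange} {c : ℝ} (hc : 0 ≤ c)
    (hl : ∀ᶠ n in atTop, logNorm (l n) ≤ ENNReal.ofReal c) {g : I → I}
    (hg : ∀ t, Tendsto (fun n => l n t) atTop (𝓝 (g t))) :
    ∃ m : TimeChange, (∀ t, m t = g t) ∧ logNorm m ≤ ENNReal.ofReal c := by
  have hg' : ∀ t, Tendsto (fun n => (l n t : ℝ)) atTop (𝓝 (g t)) := fun t =>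
    (continuous_subtype_val.tendsto _).comp (hg t)
  have h0 : (g 0 : ℝ) = 0 := by
    refine tendsto_nhds_unique (hg' 0) ?_
    have : ∀ n, l n 0 = 0 := fun n => (l n).map_bot
    simp [this]
  have h1 : (g 1 : ℝ) = 1 := by
    refine tendsto_nhds_unique (hg' 1) ?_
    have : ∀ n, l n 1 = 1 := fun n => (l n).map_top
    simp [this]
  obtain ⟨m, hm, hm'⟩ := exists_timeChange_of_bilipschitz (g := fun t => (g t : ℝ)) hc h0 h1 (by
    intro s s' hs
    have h2 := (hg' s').sub (hg' s)
    have h3 := hl.mono fun n hn => (logNorm_le_ofReal_iff hc).1 hn s s' hs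
    exact ⟨ge_of_tendsto h2 (h3.mono fun n hn => hn.1), le_of_tendsto h2 (h3.mono fun n hn => hn.2)⟩)
  exact ⟨m, fun t => Subtype.ext (hm t), hm'⟩

/-! ### Completeness of the logarithmic Skorohod distance -/

/-- `Cadlag S` with the distance `inf_l max ‖l‖⁰ (sup_t d (x t) (y (l t)))`. -/
def LogCadlag (S : Type*) [TopologicalSpace S] := Cadlag S

noncomputable instance {S : Type*} [PseudoEMetricSpace S] : PseudoEMetricSpace (LogCadlag S) where
  edist := skorohodDist logNorm
  edist_self := skorohodDist_self logNorm_refl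
  edist_comm := skorohodDist_comm logNorm_symm_le
  edist_triangle := skorohodDist_triangle logNorm_trans_le

theorem tendsto_timeChange_Iio (l : TimeChange) (t : I) : Tendsto l (𝓝[<] t) (𝓝[<] (l t)) :=
  tendsto_nhdsWithin_iff.2 ⟨l.continuous.continuousAt.mono_left nhdsWithin_le_nhds,
    eventually_mem_nhdsWithin.mono fun _ hs => l.lt_iff_lt.2 hs⟩

theorem tendsto_timeChange_Ici (l : TimeChange) (t : I) : Tendsto l (𝓝[≥] t) (𝓝[≥] (l t)) :=
  tendsto_nhdsWithin_iff.2 ⟨l.continuous.continuousAt.mono_left nhdsWithin_le_nhds,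
    eventually_mem_nhdsWithin.mono fun _ hs => l.le_iff_le.2 hs⟩

/-- The càdlàg function `x ∘ l`. -/
def Cadlag.comp {S : Type*} [TopologicalSpace S] (x : Cadlag S) (l : TimeChange) : Cadlag S where
  toFun t := x (l t)
  right_continuous' t := Tendsto.comp (x.right_continuous' (l t)) (tendsto_timeChange_Ici l t)
  left_limit' t ht := by
    have h : 0 < l t := by
      have := l.lt_iff_lt.2 ht
      rwa [show l 0 = 0 from l.map_bot] at this
    obtain ⟨a, ha⟩ := x.left_limit' (l t) h
    exact ⟨a, ha.comp (tendsto_timeChange_Iio l t)⟩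

theorem nhdsLT_neBot {t : I} (ht : 0 < t) : (𝓝[<] t).NeBot := nhdsLT_neBot_of_exists_lt ⟨0, ht⟩

/-- A uniform limit of càdlàg functions with values in a complete space is càdlàg. -/
theorem exists_cadlag_of_uniform_approx {S : Type*} [PseudoEMetricSpace S] [CompleteSpace S]
    {f : I → S} (h : ∀ ε : ℝ≥0∞, 0 < ε → ∃ x : Cadlag S, ∀ t, edist (x t) (f t) ≤ ε) :
    ∃ x : Cadlag S, ∀ t, x t = f t := by
  refine ⟨⟨f, fun t => ?_, fun t ht => ?_⟩, fun t => rfl⟩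
  · refine EMetric.tendsto_nhds.2 fun ε hε => ?_
    obtain ⟨e, he0, he⟩ : ∃ e : ℝ≥0∞, 0 < e ∧ e + e + e < ε := by
      obtain ⟨e, he0, he⟩ := exists_between hε
      refine ⟨e / 3, ENNReal.div_pos he0.ne' (by norm_num), ?_⟩
      rwa [ENNReal.add_thirds]
    obtain ⟨x, hx⟩ := h e he0
    filter_upwards [EMetric.tendsto_nhds.1 (x.right_continuous' t) e he0] with s hs
    calc edist (f s) (f t) ≤ edist (f s) (x s) + edist (x s) (x t) + edist (x t) (f t) :=
          edist_triangle4 _ _ _ _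
      _ ≤ e + e + e := by
          gcongr
          · rw [edist_comm]; exact hx s
          · exact hx t
      _ < ε := he
  · have := nhdsLT_neBot ht
    have hc : Cauchy (map f (𝓝[<] t)) := by
      refine EMetric.cauchy_iff.2 ⟨(map_neBot : (map f (𝓝[<] t)).NeBot).ne, fun ε hε => ?_⟩
      obtain ⟨e, he0, he⟩ : ∃ e : ℝ≥0∞, 0 < e ∧ e + e + (e + e) < ε := by
        obtain ⟨e, he0, he⟩ := exists_between hε
        refine ⟨e / 2 / 2, ENNReal.div_pos (ENNReal.div_pos he0.ne' (by norm_num)).ne'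
          (by norm_num), ?_⟩
        rwa [ENNReal.add_halves, ENNReal.add_halves]
      obtain ⟨x, hx⟩ := h e he0
      obtain ⟨a, ha⟩ := x.left_limit' t ht
      have h1 := EMetric.tendsto_nhds.1 ha e he0
      refine ⟨f '' {s | edist (x s) a < e}, image_mem_map h1, ?_⟩
      rintro _ ⟨s, hs, rfl⟩ _ ⟨s', hs', rfl⟩
      calc edist (f s) (f s') ≤ edist (f s) a + edist a (f s') := edist_triangle _ _ _
        _ ≤ (edist (f s) (x s) + edist (x s) a) + (edist a (x s') + edist (x s') (f s')) := by
            gcongr <;> exact edist_triangle _ _ _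
        _ ≤ e + e + (e + e) := by
            gcongr
            · rw [edist_comm]; exact hx s
            · exact hs.le
            · rw [edist_comm]; exact le_of_lt hs'
            · exact hx s'
        _ < ε := he
    exact CompleteSpace.complete hc

/-- Composing the time changes between consecutive terms gives `ν n`, which converges to a time
change `g`. The realigned functions `u n ∘ ν n` converge uniformly to some `f`, and the limit of the
sequence is `f ∘ g⁻¹`, with `g ∘ (ν n)⁻¹` as time change for the `n`-th term. -/
instance {S : Type*} [PseudoEMetricSpace S] [CompleteSpace S] : CompleteSpace (LogCadlag S) := by
  refine EMetric.complete_of_convergent_controlled_sequences (fun n => 1 / 2 ^ n)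
    (fun n => ENNReal.div_pos one_ne_zero (by finiteness)) fun w hw => ?_
  let u : ℕ → Cadlag S := w
  have hex : ∀ n, ∃ μ : TimeChange, logNorm μ < 1 / 2 ^ n ∧ unifDist (u n) (u (n + 1)) μ < 1 / 2 ^ n := by
    intro n
    have h : skorohodDist logNorm (u n) (u (n + 1)) < 1 / 2 ^ n := hw n n (n + 1) le_rfl (by simp)
    obtain ⟨μ, hμ⟩ := iInf_lt_iff.1 h
    exact ⟨μ, max_lt_iff.1 hμ⟩
  choose μ hμ hμ' using hex
  -- The compositions `μ (n - 1) ∘ ⋯ ∘ μ 0`.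
  let ν : ℕ → TimeChange := fun n => Nat.rec (OrderIso.refl I) (fun n l => l.trans (μ n)) n
  have hν : ∀ n t, ν (n + 1) t = μ n (ν n t) := fun n t => rfl
  have hstep : ∀ t n, edist (ν n t) (ν (n + 1) t) ≤ 2 / 2 ^ n := by
    intro t n
    have h1 : logNorm (μ n) ≤ 1 := (hμ n).le.trans (by
      rw [one_div]; exact ENNReal.inv_le_one.2 (one_le_pow₀ (by norm_num)))
    rw [hν, edist_comm]
    refine (le_iSup (fun t => edist (μ n t) t) (ν n t)).trans
      ((supDev_le_two_mul_logNorm h1).trans ?_)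
    calc 2 * logNorm (μ n) ≤ 2 * (1 / 2 ^ n) := by gcongr; exact (hμ n).le
      _ = 2 / 2 ^ n := by rw [mul_one_div]
  have hlim : ∀ t, ∃ a, Tendsto (fun n => ν n t) atTop (𝓝 a) := fun t =>
    cauchySeq_tendsto_of_complete
      (cauchySeq_of_edist_le_geometric_two 2 (by simp) (hstep t))
  choose g hg using hlim
  -- The remaining geometric tail is kept on the left so that the induction telescopes.
  have hlog : ∀ n k, logNorm ((ν n).symm.trans (ν (n + k))) + 2 / 2 ^ (n + k) ≤ 2 / 2 ^ n := by
    intro n k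
    induction k with
    | zero =>
      have : (ν n).symm.trans (ν (n + 0)) = OrderIso.refl I := by ext t; simp
      rw [this, logNorm_refl]; simp
    | succ k ih =>
      have : (ν n).symm.trans (ν (n + (k + 1))) = ((ν n).symm.trans (ν (n + k))).trans (μ (n + k)) :=
        rfl
      refine le_trans ?_ ih
      rw [this]
      have e1 : (2 : ℝ≥0∞) / 2 ^ (n + k) = 1 / 2 ^ (n + k) + 2 / 2 ^ (n + (k + 1)) := by
        have : (2 : ℝ≥0∞) / 2 ^ (n + (k + 1)) = 1 / 2 ^ (n + k) := by
          rw [← add_assoc, pow_succ, mul_comm, ← ENNReal.mul_div_mul_left 1 _ two_ne_zero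
            ENNReal.ofNat_ne_top, mul_one]
        rw [this, ENNReal.div_add_div_same, one_add_one_eq_two]
      rw [e1, ← add_assoc (logNorm _)]
      exact add_le_add ((logNorm_trans_le _ _).trans (add_le_add le_rfl (hμ _).le)) le_rfl
  have hofReal : ∀ n : ℕ, (2 : ℝ≥0∞) / 2 ^ n = ENNReal.ofReal (2 / 2 ^ n) := fun n => by
    rw [ENNReal.ofReal_div_of_pos (by positivity), ENNReal.ofReal_pow (by norm_num)]; simp
  have hL : ∀ n, ∃ m : TimeChange, (∀ t, m t = g ((ν n).symm t)) ∧
      logNorm m ≤ ENNReal.ofReal (2 / 2 ^ n) := by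
    intro n
    refine exists_timeChange_of_tendsto (l := fun k => (ν n).symm.trans (ν k)) (by positivity) ?_
      (fun t => hg _)
    filter_upwards [eventually_ge_atTop n] with k hk
    obtain ⟨k, rfl⟩ := Nat.exists_eq_add_of_le hk
    rw [← hofReal]
    exact le_self_add.trans (hlog n k)
  choose L hLg hL using hL
  -- `ν 0` is the identity, so `L 0` is `g` as a time change.
  have hL0 : ∀ t, L 0 t = g t := fun t => hLg 0 t
  -- The functions `u n ∘ ν n` converge uniformly.
  have hy : ∀ t n, edist (u n (ν n t)) (u (n + 1) (ν (n + 1) t)) ≤ 1 / 2 ^ n := fun t n =>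
    (le_iSup (fun s => edist (u n s) (u (n + 1) (μ n s))) (ν n t)).trans (hμ' n).le
  have hlimy : ∀ t, ∃ a, Tendsto (fun n => u n (ν n t)) atTop (𝓝 a) := fun t =>
    cauchySeq_tendsto_of_complete
      (cauchySeq_of_edist_le_geometric_two 1 (by simp) (hy t))
  choose f hf using hlimy
  have hfd : ∀ n t, edist (u n (ν n t)) (f t) ≤ 2 / 2 ^ n := fun n t => by
    have := edist_le_of_edist_le_geometric_two_of_tendsto 1 (hy t) (hf t) n
    rwa [mul_one] at this
  have hto : Tendsto (fun n : ℕ => (2 : ℝ≥0∞) / 2 ^ n) atTop (𝓝 0) := by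
    have h1 : Tendsto (fun n : ℕ => (2 : ℝ) / 2 ^ n) atTop (𝓝 0) :=
      tendsto_const_nhds.div_atTop (tendsto_pow_atTop_atTop_of_one_lt (by norm_num))
    have := ENNReal.tendsto_ofReal h1
    simpa only [← hofReal, ENNReal.ofReal_zero] using this
  obtain ⟨y, hy⟩ := exists_cadlag_of_uniform_approx (f := f) fun ε hε => by
    obtain ⟨n, hn⟩ := (hto.eventually (gt_mem_nhds hε)).exists
    exact ⟨Cadlag.comp (u n) (ν n), fun t => (hfd n t).trans hn.le⟩
  refine ⟨Cadlag.comp y (L 0).symm, tendsto_iff_edist_tendsto_0.2 ?_⟩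
  refine tendsto_of_tendsto_of_tendsto_of_le_of_le tendsto_const_nhds hto (fun n => zero_le)
    fun n => ?_
  refine iInf_le_of_le (L n) (max_le ((hL n).trans_eq (hofReal n).symm) (iSup_le fun t => ?_))
  obtain ⟨s, rfl⟩ := (ν n).surjective t
  have : (Cadlag.comp y (L 0).symm : I → S) (L n (ν n s)) = f s := by
    change y ((L 0).symm (L n (ν n s))) = f s
    rw [hLg, OrderIso.symm_apply_apply, ← hL0, OrderIso.symm_apply_apply, hy]
  exact (congrArg (edist (u n (ν n s))) this).trans_le (hfd n s)

instance : CompleteSpace D := inferInstanceAs (CompleteSpace (LogCadlag ℝ))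

/-- The logarithmic Skorohod distance is finer than the one with the uniform size of time
changes. -/
theorem skorohodDist_supDev_le {S : Type*} [PseudoEMetricSpace S] {x y : Cadlag S} {ε : ℝ≥0∞}
    (hε : ε ≤ 1) (h : skorohodDist logNorm x y < ε) : skorohodDist supDev x y < 2 * ε := by
  obtain ⟨l, hl⟩ := iInf_lt_iff.1 h
  obtain ⟨h1, h2⟩ := max_lt_iff.1 hl
  have hε0 : ε ≠ 0 := (zero_le.trans_lt h1).ne'
  have hεt : ε ≠ ∞ := ne_top_of_le_ne_top ENNReal.one_ne_top hε
  refine iInf_lt_iff.2 ⟨l, max_lt ?_ (h2.trans_le ?_)⟩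
  · refine (supDev_le_two_mul_logNorm (h1.le.trans hε)).trans_lt ?_
    exact (ENNReal.mul_lt_mul_iff_right two_ne_zero ENNReal.ofNat_ne_top).2 h1
  · rw [two_mul]; exact le_self_add

theorem continuous_logCadlag_id : @Continuous (LogCadlag D) DD _ _ (fun x => x) := by
  refine EMetric.continuous_iff.2 fun y ε hε => ?_
  refine ⟨min 1 (ε / 2), lt_min one_pos (ENNReal.div_pos hε.ne' (by norm_num)), fun x hx => ?_⟩
  change skorohodDist supDev (S := D) x y < ε
  refine (skorohodDist_supDev_le (min_le_left _ _) hx).trans_le ?_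
  calc 2 * min 1 (ε / 2) ≤ 2 * (ε / 2) := by gcongr; exact min_le_right _ _
    _ = ε := ENNReal.mul_div_cancel two_ne_zero ENNReal.ofNat_ne_top

/-! ### Sparse partitions -/

section Partition

variable {S : Type*} [PseudoEMetricSpace S]

/-- There is a partition of `[0,1]` with gaps at least `η` such that `x` stays within `ε` of its
left end value on each half-open interval of the partition. -/
def HasPartition (x : Cadlag S) (η : ℝ) (ε : ℝ≥0∞) : Prop :=
  ∃ (r : ℕ) (p : ℕ → I), p 0 = 0 ∧ p r = 1 ∧ ∀ i < r, η ≤ (p (i + 1) : ℝ) - p i ∧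
    ∀ u, p i ≤ u → u < p (i + 1) → edist (x u) (x (p i)) ≤ ε

theorem HasPartition.mono {x : Cadlag S} {η η' : ℝ} {ε ε' : ℝ≥0∞} (h : HasPartition x η ε)
    (hη : η' ≤ η) (hε : ε ≤ ε') : HasPartition x η' ε' := by
  obtain ⟨r, p, h0, h1, hp⟩ := h
  exact ⟨r, p, h0, h1, fun i hi => ⟨hη.trans (hp i hi).1,
    fun u hu hu' => ((hp i hi).2 u hu hu').trans hε⟩⟩

/-- Taking the first index whose point exceeds `u` avoids any monotonicity assumption on `p`. -/
theorem exists_partition_index {p : ℕ → I} {r : ℕ} (h0 : p 0 = 0) (h1 : p r = 1) {u : I}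
    (hu : u < 1) : ∃ i < r, p i ≤ u ∧ u < p (i + 1) := by
  classical
  have hex : ∃ k, u < p k := ⟨r, h1 ▸ hu⟩
  have hpos : Nat.find hex ≠ 0 := by
    intro h
    have := Nat.find_spec hex
    rw [h, h0] at this
    exact absurd this (not_lt.2 u.2.1)
  obtain ⟨k, hk⟩ := Nat.exists_eq_succ_of_ne_zero hpos
  refine ⟨k, ?_, ?_, ?_⟩
  · have : Nat.find hex ≤ r := Nat.find_le (h1 ▸ hu)
    omega
  · exact not_lt.1 (Nat.find_min hex (by omega))
  · have := Nat.find_spec hex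
    rwa [hk] at this

/-- Points of `[0,1]` at distance less than `η` lie in the same or in adjacent intervals of a
partition with gaps at least `η`; so one of two neighbouring increments is small. -/
theorem HasPartition.min_edist_le {x : Cadlag S} {η : ℝ} {ε : ℝ≥0∞} (h : HasPartition x η ε)
    {s₁ s s₂ : I} (h1 : s₁ ≤ s) (h2 : s ≤ s₂) (h3 : (s₂ : ℝ) - s₁ < η) :
    min (edist (x s) (x s₁)) (edist (x s₂) (x s)) ≤ 2 * ε := by
  obtain ⟨r, p, hp0, hp1, hp⟩ := h
  have same : ∀ i < r, ∀ u v, p i ≤ u → u < p (i + 1) → p i ≤ v → v < p (i + 1) →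
      edist (x u) (x v) ≤ 2 * ε := fun i hi u v hu hu' hv hv' => by
    refine (edist_triangle_right _ _ (x (p i))).trans ?_
    rw [two_mul]
    exact add_le_add ((hp i hi).2 u hu hu') ((hp i hi).2 v hv hv')
  rcases (show s₁ ≤ 1 from s₁.2.2).eq_or_lt with h4 | h4
  · have : s = s₁ := le_antisymm (h4 ▸ s.2.2) h1
    simp [this]
  obtain ⟨i, hi, hi1, hi2⟩ := exists_partition_index hp0 hp1 h4
  rcases lt_or_ge s (p (i + 1)) with h5 | h5
  · exact (min_le_left _ _).trans (same i hi _ _ (hi1.trans h1) h5 hi1 hi2)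
  rcases h2.eq_or_lt with h6 | h6
  · simp [h6]
  have h7 : i + 1 < r := by
    rcases (Nat.succ_le_of_lt hi).eq_or_lt with h8 | h8
    · have h9 : p (i + 1) = 1 := by rw [← hp1, ← h8]
      exact absurd (h5.trans_lt h6) (not_lt.2 (h9 ▸ s₂.2.2))
    · exact h8
  refine (min_le_right _ _).trans (same (i + 1) h7 _ _ (h5.trans h2) ?_ h5 (h6.trans ?_)) <;>
  · have h10 := (hp (i + 1) h7).1
    have h11 : (s₁ : ℝ) < p (i + 1) := hi2
    exact Subtype.coe_lt_coe.1 (by linarith)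

theorem HasPartition.wSecond_le {x : Cadlag S} {η δ : ℝ} {ε : ℝ≥0∞} (h : HasPartition x η ε)
    (hδ : δ < η) : wSecond x δ ≤ 2 * ε :=
  iSup_le fun _ => iSup_le fun _ => iSup_le fun _ => iSup_le fun hs =>
    h.min_edist_le hs.1 hs.2.1 (hs.2.2.trans_lt hδ)

theorem HasPartition.edist_zero_le {x : Cadlag S} {η : ℝ} {ε : ℝ≥0∞} (h : HasPartition x η ε)
    {δ : I} (hδ : (δ : ℝ) < η) : edist (x δ) (x 0) ≤ ε := by
  obtain ⟨r, p, hp0, hp1, hp⟩ := h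
  have hr : 0 < r := by
    rcases Nat.eq_zero_or_pos r with rfl | h
    · exact absurd (hp0.symm.trans hp1) zero_ne_one
    · exact h
  have := hp 0 hr
  rw [hp0] at this
  refine this.2 δ δ.2.1 (Subtype.coe_lt_coe.1 ?_)
  have h2 := this.1
  simp only [Set.Icc.coe_zero, sub_zero] at h2
  linarith

/-- `Function.leftLim` has a default value where no limit exists; `left_limit'` makes it a genuine
limit here, determined up to distance zero. -/
theorem tendsto_leftLim (x : Cadlag S) {t : I} (ht : 0 < t) :
    Tendsto x (𝓝[<] t) (𝓝 (Function.leftLim x t)) :=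
  tendsto_leftLim_of_tendsto (x.left_limit' t ht)

/-- As `δ < η`, the point `σ δ` lies in the last interval of the partition, where `x` oscillates by
at most `2 * ε`. -/
theorem HasPartition.edist_leftLim_le {x : Cadlag S} {η : ℝ} {ε : ℝ≥0∞} (h : HasPartition x η ε)
    {δ : I} (h0 : 0 < δ) (hδ : (δ : ℝ) < η) :
    edist (Function.leftLim x 1) (x (σ δ)) ≤ 2 * ε := by
  obtain ⟨r, p, hp0, hp1, hp⟩ := h
  have h1 : σ δ < 1 := by
    refine Subtype.coe_lt_coe.1 ?_
    have : (0 : ℝ) < δ := h0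
    simpa using this
  obtain ⟨i, hi, hi1, hi2⟩ := exists_partition_index hp0 hp1 h1
  have hir : p (i + 1) = 1 := by
    rcases (Nat.succ_le_of_lt hi).eq_or_lt with h8 | h8
    · rw [← hp1, ← h8]
    · have h2 := (hp (i + 1) h8).1
      have h3 : ((σ δ : I) : ℝ) < p (i + 1) := hi2
      have h4 := (p (i + 1 + 1)).2.2
      rw [coe_symm_eq] at h3
      linarith
  have := nhdsLT_neBot (zero_lt_one (α := I))
  refine le_of_tendsto ((tendsto_leftLim x zero_lt_one).edist tendsto_const_nhds) ?_
  filter_upwards [Ioo_mem_nhdsLT h1] with s hs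
  refine (edist_triangle_right _ _ (x (p i))).trans ?_
  rw [two_mul]
  exact add_le_add ((hp i hi).2 _ (hi1.trans hs.1.le) (hir ▸ hs.2)) ((hp i hi).2 _ hi1 hi2)

/-- Partitions are stable under perturbations of the function. -/
theorem HasPartition.of_skorohodDist_lt {x y : Cadlag S} {η ρ : ℝ} {ε ε' : ℝ≥0∞}
    (h : HasPartition y η ε) (hρ : skorohodDist supDev x y < ENNReal.ofReal ρ)
    (hε : skorohodDist supDev x y < ε') : HasPartition x (η - 2 * ρ) (ε' + ε + ε') := by
  obtain ⟨l, hl⟩ := iInf_lt_iff.1 (lt_min hρ hε)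
  obtain ⟨hl1, hl2⟩ := max_lt_iff.1 hl
  obtain ⟨r, p, hp0, hp1, hp⟩ := h
  have hdev : ∀ t, |(l t : ℝ) - t| < ρ := by
    intro t
    have h1 : edist (l t) t < ENNReal.ofReal ρ :=
      (le_iSup (fun t => edist (l t) t) t).trans_lt (hl1.trans_le (min_le_left _ _))
    rw [edist_lt_ofReal] at h1
    exact h1
  have hun : ∀ t, edist (x t) (y (l t)) ≤ ε' := fun t =>
    (le_iSup (fun t => edist (x t) (y (l t))) t).trans (hl2.le.trans (min_le_right _ _))
  -- The partition is pulled back along `l`. Each point moves by less than `ρ`, so a gap shrinks by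
  -- less than `2 * ρ`.
  refine ⟨r, fun i => l.symm (p i), ?_, ?_, fun i hi => ⟨?_, fun u hu hu' => ?_⟩⟩
  · simp only [hp0]; exact l.symm.map_bot
  · simp only [hp1]; exact l.symm.map_top
  · have h1 := abs_lt.1 (hdev (l.symm (p i)))
    have h2 := abs_lt.1 (hdev (l.symm (p (i + 1))))
    rw [l.apply_symm_apply] at h1 h2
    have := (hp i hi).1
    linarith
  · have h1 := (hp i hi).2 (l u) (l.symm_apply_le.1 hu) (l.lt_symm_apply.1 hu')
    refine (edist_triangle4 _ (y (l u)) (y (p i)) _).trans ?_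
    refine add_le_add (add_le_add (hun u) h1) ?_
    have := hun (l.symm (p i))
    rwa [l.apply_symm_apply, edist_comm] at this

/-! ### From the second modulus to partitions -/

/-- If `w''(x,δ) < ε`, then `x` has at most one large jump on an interval of length at most `δ`. -/
theorem exists_jump_of_wSecond_lt {x : Cadlag S} {δ : ℝ} {ε : ℝ≥0∞} (h : wSecond x δ < ε)
    {a b : I} (hab : a ≤ b) (hδ : (b : ℝ) - a ≤ δ) :
    ∃ τ, a ≤ τ ∧ τ ≤ b ∧ (∀ u, a ≤ u → u < τ → edist (x u) (x a) ≤ ε) ∧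
      ∀ u, τ ≤ u → u ≤ b → edist (x u) (x τ) ≤ ε := by
  by_cases hne : ∃ s, a ≤ s ∧ s ≤ b ∧ ε ≤ edist (x s) (x a)
  swap
  · push Not at hne
    refine ⟨b, hab, le_rfl, fun u hu hu' => (hne u hu hu'.le).le, fun u hu hu' => ?_⟩
    rw [le_antisymm hu' hu, edist_self]
    exact zero_le
  -- The jump time is `sInf T`. Right continuity puts it in `T`, so after it the modulus can only be
  -- small through the second increment.
  let T : Set I := {s | a ≤ s ∧ s ≤ b ∧ ε ≤ edist (x s) (x a)}
  have hT : T.Nonempty := hne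
  have haτ : a ≤ sInf T := le_sInf fun s hs => hs.1
  have hτb : sInf T ≤ b := let ⟨s, hs⟩ := hT; (sInf_le hs).trans hs.2.1
  have hτ : ε ≤ edist (x (sInf T)) (x a) := by
    by_contra hlt
    push Not at hlt
    have h1 : ∀ᶠ s in 𝓝[≥] (sInf T), edist (x s) (x a) < ε :=
      (((x.right_continuous' (sInf T)).tendsto).edist tendsto_const_nhds).eventually
        (gt_mem_nhds hlt)
    rcases (show sInf T ≤ 1 from (sInf T).2.2).eq_or_lt with h2 | h2
    · obtain ⟨s, hs⟩ := hT
      have h3 : s = sInf T := le_antisymm (h2 ▸ s.2.2) (sInf_le hs)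
      exact absurd (h3 ▸ hs.2.2) (not_le.2 hlt)
    · obtain ⟨u, hu, hu'⟩ := (mem_nhdsGE_iff_exists_Ico_subset' h2).1 h1
      obtain ⟨s, hs, hsu⟩ := sInf_lt_iff.1 (show sInf T < u from hu)
      exact absurd hs.2.2 (not_le.2 (hu' ⟨sInf_le hs, hsu⟩))
  refine ⟨sInf T, haτ, hτb, fun u hu hu' => ?_, fun u hu hu' => ?_⟩
  · by_contra hc
    exact absurd (sInf_le (show u ∈ T from ⟨hu, hu'.le.trans hτb, (not_le.1 hc).le⟩)) (not_le.2 hu')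
  · have h1 : min (edist (x (sInf T)) (x a)) (edist (x u) (x (sInf T))) ≤ wSecond x δ :=
      le_iSup_of_le a (le_iSup_of_le (sInf T) (le_iSup_of_le u (le_iSup_of_le
        ⟨haτ, hu, (sub_le_sub_right (show (u : ℝ) ≤ b from hu') _).trans hδ⟩ le_rfl)))
    rcases min_lt_iff.1 (h1.trans_lt h) with h2 | h2
    · exact absurd hτ (not_le.2 h2)
    · exact h2.le

/-- A greedy construction from the left, with the invariant that `x` stays within `2 * ε` of `x t`
on `[t, t + η)`. The window `[t, t + 3η]` contains at most one large jump `τ`. The next point is `τ`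
if it lies in `[t + η, t + 2η]`, and `t + η` otherwise; in each case the gap is at least `η` and the
invariant persists. Once less than `3η` remains, the last interval ends at `1` and is controlled by
the left limit there. -/
theorem HasPartition.of_wSecond_lt {x : Cadlag S} {η : ℝ} {ε : ℝ≥0∞} (hη : 0 < η)
    (hη3 : 3 * η < 1)
    (h1 : wSecond x (3 * η) < ε) (h2 : ∀ u : I, (u : ℝ) < η → edist (x u) (x 0) ≤ ε)
    (h3 : ∀ u : I, 1 - 3 * η < (u : ℝ) → u < 1 → edist (Function.leftLim x 1) (x u) ≤ ε) :
    HasPartition x η (2 * ε) := by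
  have hε2 : ε ≤ 2 * ε := by rw [two_mul]; exact le_self_add
  -- `n` bounds the number of steps left. The condition `t ≤ 1 - η` keeps the last gap long enough
  -- and rules out `n = 0`.
  have key : ∀ (n : ℕ) (t : I), 1 - (t : ℝ) ≤ n * η → (t : ℝ) ≤ 1 - η →
      (∀ u : I, t ≤ u → (u : ℝ) < t + η → edist (x u) (x t) ≤ 2 * ε) →
      ∃ (r : ℕ) (p : ℕ → I), p 0 = t ∧ p r = 1 ∧ ∀ i < r, η ≤ (p (i + 1) : ℝ) - p i ∧
        ∀ u, p i ≤ u → u < p (i + 1) → edist (x u) (x (p i)) ≤ 2 * ε := by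
    intro n
    induction n with
    | zero =>
      intro t ht ht'
      simp only [Nat.cast_zero, zero_mul] at ht
      linarith
    | succ n ih =>
      intro t ht htη hflat
      push_cast at ht
      by_cases hend : 1 < (t : ℝ) + 3 * η
      · refine ⟨1, fun i => if i = 0 then t else 1, by simp, by simp, fun i hi => ?_⟩
        obtain rfl : i = 0 := by omega
        have ht1 : t < 1 := Subtype.coe_lt_coe.1 (by simp only [Set.Icc.coe_one]; linarith)
        refine ⟨by simp; linarith, fun u hu hu' => ?_⟩
        simp only [if_true, zero_add, one_ne_zero, if_false] at hu hu' ⊢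
        have hu0 : (t : ℝ) ≤ u := hu
        refine (edist_triangle_left _ _ (Function.leftLim x 1)).trans ?_
        rw [two_mul]
        exact add_le_add (h3 u (by linarith) hu') (h3 t (by linarith) ht1)
      push Not at hend
      have t0 := t.2.1
      let b : I := ⟨t + 3 * η, by linarith, hend⟩
      obtain ⟨τ, hτ1, hτ2, hτ3, hτ4⟩ := exists_jump_of_wSecond_lt h1 (a := t) (b := b)
        (Subtype.coe_le_coe.1 (by change (t : ℝ) ≤ t + 3 * η; linarith))
        (by change (t : ℝ) + 3 * η - t ≤ _; linarith)
      have hτ2' : (τ : ℝ) ≤ t + 3 * η := hτ2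
      have hb : ∀ u : I, (u : ℝ) ≤ t + 3 * η → u ≤ b := fun u hu => hu
      -- It suffices to find the next point of the partition.
      suffices hnext : ∃ t' : I, (t : ℝ) + η ≤ t' ∧ (t' : ℝ) ≤ t + 2 * η ∧
          (∀ u, t ≤ u → u < t' → edist (x u) (x t) ≤ 2 * ε) ∧
          ∀ u : I, t' ≤ u → (u : ℝ) < t' + η → edist (x u) (x t') ≤ 2 * ε by
        obtain ⟨t', e1, e2, e3, e4⟩ := hnext
        obtain ⟨r, p, hp0, hp1, hp⟩ := ih t' (by linarith) (by linarith) e4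
        refine ⟨r + 1, fun i => Nat.casesOn i t p, rfl, hp1, fun i hi => ?_⟩
        rcases i with _ | i
        · change η ≤ (p 0 : ℝ) - t ∧ ∀ u, t ≤ u → u < p 0 → _
          rw [hp0]
          exact ⟨by linarith, e3⟩
        · exact hp i (by omega)
      let c : I := ⟨t + η, by linarith, by linarith⟩
      have hc : (c : ℝ) = t + η := rfl
      rcases lt_or_ge (τ : ℝ) (t + η) with hτη | hτη
      · refine ⟨c, le_rfl, by linarith, fun u hu hu' => hflat u hu hu', fun u hu hu' => ?_⟩
        have hτc : τ ≤ c := hτη.le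
        refine (edist_triangle_right _ _ (x τ)).trans ?_
        rw [two_mul]
        exact add_le_add (hτ4 u (hτc.trans hu) (hb u (by linarith)))
          (hτ4 c hτc (hb c (by linarith)))
      rcases le_or_gt (τ : ℝ) (t + 2 * η) with hτη' | hτη'
      · exact ⟨τ, hτη, hτη', fun u hu hu' => (hτ3 u hu hu').trans hε2,
          fun u hu hu' => (hτ4 u hu (hb u (by linarith))).trans hε2⟩
      · have htc : t ≤ c := Subtype.coe_le_coe.1 (by linarith)
        have hlt : ∀ u : I, (u : ℝ) < t + 2 * η → u < τ := fun u hu =>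
          Subtype.coe_lt_coe.1 (hu.trans hτη')
        refine ⟨c, le_rfl, by linarith, fun u hu hu' => hflat u hu hu', fun u hu hu' => ?_⟩
        refine (edist_triangle_right _ _ (x t)).trans ?_
        rw [two_mul]
        exact add_le_add (hτ3 u (htc.trans hu) (hlt u (by linarith)))
          (hτ3 c htc (hlt c (by linarith)))
  obtain ⟨n, hn⟩ := exists_nat_ge (1 / η)
  refine key n 0 ?_ ?_ ?_
  · rw [div_le_iff₀ hη] at hn
    simpa using hn
  · simp only [Set.Icc.coe_zero]; linarith
  · intro u _ hu
    simp only [Set.Icc.coe_zero, zero_add] at hu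
    exact (h2 u hu).trans hε2

/-! ### A single càdlàg function -/

/-- Each `t` has a neighbourhood on which `x` oscillates by at most `ε` on either side of `t`. At
the scale of a Lebesgue number all three points lie in one such neighbourhood, and the middle point
shares its side of `t` with an outer one. -/
theorem exists_wSecond_lt (x : Cadlag S) {ε : ℝ≥0∞} (hε : 0 < ε) :
    ∃ δ : ℝ, 0 < δ ∧ wSecond x δ ≤ ε := by
  have hloc : ∀ t : I, ∃ U : Set I, IsOpen U ∧ t ∈ U ∧
      (∀ u ∈ U, ∀ v ∈ U, u < t → v < t → edist (x u) (x v) ≤ ε) ∧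
      (∀ u ∈ U, ∀ v ∈ U, t ≤ u → t ≤ v → edist (x u) (x v) ≤ ε) := by
    intro t
    have hε2 : 0 < ε / 2 := ENNReal.div_pos hε.ne' (by norm_num)
    have aux : ∀ (s : Set I) (a : S), Tendsto x (𝓝[s] t) (𝓝 a) → ∃ U : Set I, IsOpen U ∧ t ∈ U ∧
        ∀ u ∈ U, ∀ v ∈ U, u ∈ s → v ∈ s → edist (x u) (x v) ≤ ε := by
      intro s a ha
      obtain ⟨U, hU, htU, hUs⟩ := mem_nhdsWithin.1 (EMetric.tendsto_nhds.1 ha _ hε2)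
      refine ⟨U, hU, htU, fun u hu v hv hus hvs => ?_⟩
      rw [← ENNReal.add_halves ε]
      exact (edist_triangle_right _ _ a).trans
        (add_le_add (le_of_lt (hUs ⟨hu, hus⟩)) (le_of_lt (hUs ⟨hv, hvs⟩)))
    obtain ⟨U, hU, htU, hU'⟩ := aux (Ici t) _ (x.right_continuous' t)
    obtain ⟨V, hV, htV, hV'⟩ : ∃ V : Set I, IsOpen V ∧ t ∈ V ∧
        ∀ u ∈ V, ∀ v ∈ V, u ∈ Iio t → v ∈ Iio t → edist (x u) (x v) ≤ ε := by
      rcases (show 0 ≤ t from t.2.1).eq_or_lt with h0 | h0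
      · exact ⟨univ, isOpen_univ, trivial, fun u _ v _ hu _ =>
          absurd (h0 ▸ hu : u < 0) (not_lt.2 u.2.1)⟩
      · obtain ⟨a, ha⟩ := x.left_limit' t h0
        exact aux _ a ha
    exact ⟨U ∩ V, hU.inter hV, ⟨htU, htV⟩, fun u hu v hv => hV' u hu.2 v hv.2,
      fun u hu v hv => hU' u hu.1 v hv.1⟩
  choose U hUo htU hUl hUr using hloc
  obtain ⟨δ, hδ, hδ'⟩ := lebesgue_number_lemma_of_metric isCompact_univ hUo
    (fun t _ => mem_iUnion.2 ⟨t, htU t⟩)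
  refine ⟨δ / 2, half_pos hδ, iSup_le fun s₁ => iSup_le fun s => iSup_le fun s₂ =>
    iSup_le fun hs => ?_⟩
  obtain ⟨t, ht⟩ := hδ' s₁ trivial
  have h1 : (s₁ : ℝ) ≤ s := hs.1
  have h2 : (s : ℝ) ≤ s₂ := hs.2.1
  have h3 := hs.2.2
  have m1 : s₁ ∈ U t := ht (Metric.mem_ball_self hδ)
  have m : s ∈ U t := ht (by
    rw [Metric.mem_ball, Subtype.dist_eq, Real.dist_eq, abs_lt]; constructor <;> linarith)
  have m2 : s₂ ∈ U t := ht (by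
    rw [Metric.mem_ball, Subtype.dist_eq, Real.dist_eq, abs_lt]; constructor <;> linarith)
  rcases lt_or_ge s t with h | h
  · exact (min_le_left _ _).trans (hUl t _ m _ m1 h (hs.1.trans_lt h))
  · exact (min_le_right _ _).trans (hUr t _ m2 _ m (h.trans hs.2.1) h)

end Partition

section Modulus

variable {S : Type*} [PseudoEMetricSpace S]

/-! ### Uniform partitions and the second modulus -/

theorem wSecond_mono (x : Cadlag S) {δ δ' : ℝ} (h : δ ≤ δ') : wSecond x δ ≤ wSecond x δ' :=
  iSup_mono fun _ => iSup_mono fun _ => iSup_mono fun _ => iSup_le fun hs =>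
    le_iSup_of_le ⟨hs.1, hs.2.1, hs.2.2.trans h⟩ le_rfl

theorem exists_uniform_partition {A : Set (Cadlag S)}
    (h1 : ∀ ε : ℝ≥0∞, 0 < ε → ∃ δ : ℝ, 0 < δ ∧ ∀ x ∈ A, wSecond x δ ≤ ε)
    (h2 : ∀ ε : ℝ≥0∞, 0 < ε → ∃ δ : ℝ, 0 < δ ∧ ∀ x ∈ A, ∀ u : I, (u : ℝ) < δ →
      edist (x u) (x 0) ≤ ε)
    (h3 : ∀ ε : ℝ≥0∞, 0 < ε → ∃ δ : ℝ, 0 < δ ∧ ∀ x ∈ A, ∀ u : I, 1 - δ < (u : ℝ) → u < 1 →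
      edist (Function.leftLim x 1) (x u) ≤ ε) :
    ∀ ε : ℝ≥0∞, 0 < ε → ∃ η : ℝ, 0 < η ∧ ∀ x ∈ A, HasPartition x η ε := by
  intro ε hε
  obtain ⟨e, he0, he⟩ := exists_between hε
  have he0' : 0 < e / 2 := ENNReal.div_pos he0.ne' (by norm_num)
  -- `HasPartition.of_wSecond_lt` needs a strict bound on the modulus.
  obtain ⟨e', he'0, he'⟩ := exists_between he0'
  obtain ⟨δ₁, hδ₁, h1⟩ := h1 e' he'0
  obtain ⟨δ₂, hδ₂, h2⟩ := h2 _ he0'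
  obtain ⟨δ₃, hδ₃, h3⟩ := h3 _ he0'
  have hm : 0 < min (min δ₁ δ₂) (min δ₃ 1) :=
    lt_min (lt_min hδ₁ hδ₂) (lt_min hδ₃ one_pos)
  have hm1 : min (min δ₁ δ₂) (min δ₃ 1) ≤ δ₁ := (min_le_left _ _).trans (min_le_left _ _)
  have hm2 : min (min δ₁ δ₂) (min δ₃ 1) ≤ δ₂ := (min_le_left _ _).trans (min_le_right _ _)
  have hm3 : min (min δ₁ δ₂) (min δ₃ 1) ≤ δ₃ := (min_le_right _ _).trans (min_le_left _ _)
  have hm4 : min (min δ₁ δ₂) (min δ₃ 1) ≤ 1 := (min_le_right _ _).trans (min_le_right _ _)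
  generalize min (min δ₁ δ₂) (min δ₃ 1) = m at hm hm1 hm2 hm3 hm4
  refine ⟨m / 4, by positivity, fun x hx => ?_⟩
  have : HasPartition x (m / 4) (2 * (e / 2)) :=
    HasPartition.of_wSecond_lt (by positivity) (by linarith)
      ((wSecond_mono x (by linarith)).trans (h1 x hx) |>.trans_lt he')
      (fun u hu => h2 x hx u (by linarith))
      (fun u hu hu' => h3 x hx u (by linarith) hu')
  refine this.mono le_rfl ?_
  rw [ENNReal.mul_div_cancel two_ne_zero ENNReal.ofNat_ne_top]
  exact he.le

theorem exists_hasPartition (x : Cadlag S) {ε : ℝ≥0∞} (hε : 0 < ε) :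
    ∃ η : ℝ, 0 < η ∧ HasPartition x η ε := by
  have := exists_uniform_partition (A := {x})
    (fun ε hε => by simpa using exists_wSecond_lt x hε) ?_ ?_ ε hε
  · simpa using this
  · intro ε hε
    have h := EMetric.tendsto_nhds.1 (x.right_continuous' 0).tendsto ε hε
    obtain ⟨u, hu, hu'⟩ := (mem_nhdsGE_iff_exists_Ico_subset' (zero_lt_one (α := I))).1 h
    refine ⟨u, hu, ?_⟩
    rintro _ rfl v hv
    exact le_of_lt (hu' ⟨v.2.1, hv⟩)
  · intro ε hε
    have h := EMetric.tendsto_nhds.1 (tendsto_leftLim x zero_lt_one) ε hε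
    obtain ⟨u, hu, hu'⟩ := (mem_nhdsLT_iff_exists_Ioo_subset' (zero_lt_one (α := I))).1 h
    have hu1 : (u : ℝ) < 1 := hu
    refine ⟨1 - u, by linarith, ?_⟩
    rintro _ rfl v hv hv'
    rw [edist_comm]
    exact le_of_lt (hu' ⟨Subtype.coe_lt_coe.1 (by linarith), hv'⟩)

theorem tendsto_zero_iff {F : I → ℝ≥0∞} :
    Tendsto F (𝓝[>] 0) (𝓝 0) ↔
      ∀ ε : ℝ≥0∞, 0 < ε → ∃ η : ℝ, 0 < η ∧ ∀ δ : I, 0 < δ → (δ : ℝ) < η → F δ ≤ ε := by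
  rw [ENNReal.tendsto_nhds_zero]
  refine forall₂_congr fun ε hε => ⟨fun h => ?_, ?_⟩
  · obtain ⟨u, hu, hu'⟩ := (mem_nhdsGT_iff_exists_Ioo_subset' (zero_lt_one (α := I))).1 h
    exact ⟨u, hu, fun δ h0 h1 => hu' ⟨h0, h1⟩⟩
  · rintro ⟨η, hη, h⟩
    have hlt : (0 : ℝ) < min η 1 := lt_min hη one_pos
    have : Ioo (0 : I) ⟨min η 1, hlt.le, min_le_right _ _⟩ ∈ 𝓝[>] (0 : I) :=
      Ioo_mem_nhdsGT hlt
    filter_upwards [this] with δ hδ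
    exact h δ hδ.1 ((show (δ : ℝ) < min η 1 from hδ.2).trans_le (min_le_left _ _))

/-- Partitions with uniform gaps are characterized by the second modulus and by the behaviour at
the end points. -/
theorem uniform_partition_iff {A : Set (Cadlag S)} :
    (∀ ε : ℝ≥0∞, 0 < ε → ∃ η : ℝ, 0 < η ∧ ∀ x ∈ A, HasPartition x η ε) ↔
      Tendsto (fun δ : I => ⨆ x ∈ A, wSecond x δ) (𝓝[>] 0) (𝓝 0) ∧
        Tendsto (fun δ : I => ⨆ x ∈ A, edist (x δ) (x 0)) (𝓝[>] 0) (𝓝 0) ∧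
        Tendsto (fun δ : I => ⨆ x ∈ A, edist (Function.leftLim x 1) (x (σ δ)))
          (𝓝[>] 0) (𝓝 0) := by
  simp only [tendsto_zero_iff, iSup_le_iff]
  constructor
  · intro h
    have half : ∀ ε : ℝ≥0∞, 0 < ε → 0 < ε / 2 ∧ 2 * (ε / 2) = ε := fun ε hε =>
      ⟨ENNReal.div_pos hε.ne' (by norm_num),
        ENNReal.mul_div_cancel two_ne_zero ENNReal.ofNat_ne_top⟩
    refine ⟨fun ε hε => ?_, fun ε hε => ?_, fun ε hε => ?_⟩
    · obtain ⟨η, hη, h⟩ := h _ (half ε hε).1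
      exact ⟨η, hη, fun δ _ hδ x hx => ((h x hx).wSecond_le hδ).trans_eq (half ε hε).2⟩
    · obtain ⟨η, hη, h⟩ := h _ hε
      exact ⟨η, hη, fun δ _ hδ x hx => (h x hx).edist_zero_le hδ⟩
    · obtain ⟨η, hη, h⟩ := h _ (half ε hε).1
      exact ⟨η, hη, fun δ hδ0 hδ x hx =>
        ((h x hx).edist_leftLim_le hδ0 hδ).trans_eq (half ε hε).2⟩
  · rintro ⟨h1, h2, h3⟩
    refine exists_uniform_partition (fun ε hε => ?_) (fun ε hε => ?_) (fun ε hε => ?_)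
    · obtain ⟨η, hη, h⟩ := h1 ε hε
      have hlt : (0 : ℝ) < min η 1 / 2 := half_pos (lt_min hη one_pos)
      have hle : min η 1 / 2 ≤ 1 := by linarith [min_le_right η 1]
      exact ⟨min η 1 / 2, hlt, h ⟨_, hlt.le, hle⟩ hlt
        (by change min η 1 / 2 < η; linarith [min_le_left η 1])⟩
    · obtain ⟨η, hη, h⟩ := h2 ε hε
      refine ⟨η, hη, fun x hx u hu => ?_⟩
      rcases (show 0 ≤ u from u.2.1).eq_or_lt with h0 | h0
      · rw [← h0, edist_self]; exact zero_le
      · exact h u h0 hu x hx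
    · obtain ⟨η, hη, h⟩ := h3 ε hε
      refine ⟨η, hη, fun x hx u hu hu' => ?_⟩
      have hu1 : (u : ℝ) < 1 := hu'
      have := h (σ u) (Subtype.coe_lt_coe.1 (by rw [coe_symm_eq]; simpa using hu1))
        (by rw [coe_symm_eq]; linarith) x hx
      rwa [symm_symm] at this

/-! ### Values of a family of functions -/

/-- The set of all values of the functions in a family. -/
def valueSet (A : Set (Cadlag S)) : Set S := ⋃ x ∈ A, range x

/-- The values at the points of a partition form a finite net; the index `r` accounts for `t = 1`,
which no half-open interval contains. -/
theorem totallyBounded_range (x : Cadlag S) : TotallyBounded (range x) := by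
  refine EMetric.totallyBounded_iff.2 fun ε hε => ?_
  obtain ⟨e, he0, he⟩ := exists_between hε
  obtain ⟨η, -, r, p, hp0, hp1, hp⟩ := exists_hasPartition x he0
  refine ⟨(fun i => x (p i)) '' Iic r, (finite_Iic r).image _, ?_⟩
  rintro _ ⟨u, rfl⟩
  rcases (show u ≤ 1 from u.2.2).eq_or_lt with rfl | hu
  · refine mem_biUnion ⟨r, mem_Iic.2 le_rfl, rfl⟩ ?_
    simp only [Metric.mem_eball, hp1, edist_self]
    exact hε
  · obtain ⟨i, hi, hi1, hi2⟩ := exists_partition_index hp0 hp1 hu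
    exact mem_biUnion ⟨i, mem_Iic.2 hi.le, rfl⟩ (((hp i hi).2 u hi1 hi2).trans_lt he)

/-- `A` has finite covers by balls of prescribed radii. -/
def HasFiniteSubcovers (A : Set (Cadlag S)) : Prop :=
  ∀ r : Cadlag S → ℝ≥0∞, (∀ y, 0 < r y) →
    ∃ F : Finset (Cadlag S), ∀ x ∈ A, ∃ y ∈ F, skorohodDist supDev x y < r y

theorem HasFiniteSubcovers.totallyBounded_valueSet {A : Set (Cadlag S)}
    (hA : HasFiniteSubcovers A) : TotallyBounded (valueSet A) := by
  refine EMetric.totallyBounded_iff.2 fun ε hε => ?_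
  have hε2 : 0 < ε / 2 := ENNReal.div_pos hε.ne' (by norm_num)
  obtain ⟨F, hF⟩ := hA (fun _ => ε / 2) fun _ => hε2
  choose T hT hT' using fun y : Cadlag S =>
    EMetric.totallyBounded_iff.1 (totallyBounded_range y) (ε / 2) hε2
  refine ⟨⋃ y ∈ F, T y, F.finite_toSet.biUnion fun y _ => hT y, ?_⟩
  intro z hz
  obtain ⟨x, hx, t, rfl⟩ := mem_iUnion₂.1 hz
  obtain ⟨y, hy, hxy⟩ := hF x hx
  obtain ⟨l, hl⟩ := iInf_lt_iff.1 hxy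
  have h1 : edist (x t) (y (l t)) < ε / 2 :=
    (le_iSup (fun t => edist (x t) (y (l t))) t).trans_lt (max_lt_iff.1 hl).2
  obtain ⟨w, hw, hw'⟩ := mem_iUnion₂.1 (hT' y ⟨l t, rfl⟩)
  refine mem_biUnion (mem_biUnion hy hw) ?_
  rw [Metric.mem_eball] at hw' ⊢
  refine (edist_triangle _ (y (l t)) _).trans_lt ?_
  rw [← ENNReal.add_halves ε]
  exact ENNReal.add_lt_add h1 hw'

/-- Radii depending on the centre matter here: around `y` the radius is at most `η y / 4`, so
passing to a function in the ball costs at most half of the gap `η y`. -/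
theorem HasFiniteSubcovers.uniform_partition {A : Set (Cadlag S)} (hA : HasFiniteSubcovers A)
    (ε : ℝ≥0∞) (hε : 0 < ε) : ∃ η : ℝ, 0 < η ∧ ∀ x ∈ A, HasPartition x η ε := by
  have hε3 : 0 < ε / 3 := ENNReal.div_pos hε.ne' (by norm_num)
  choose η hη hp using fun y : Cadlag S => exists_hasPartition y hε3
  obtain ⟨F, hF⟩ := hA (fun y => min (ENNReal.ofReal (η y / 4)) (ε / 3)) fun y =>
    lt_min (ENNReal.ofReal_pos.2 (by linarith [hη y])) hε3
  have hev : ∀ᶠ e : ℝ in 𝓝[>] 0, ∀ y ∈ F, e < η y / 2 :=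
    (Filter.eventually_all_finset F).2 fun y _ =>
      nhdsWithin_le_nhds (gt_mem_nhds (half_pos (hη y)))
  obtain ⟨e, he, he0⟩ := (hev.and eventually_mem_nhdsWithin).exists
  refine ⟨e, he0, fun x hx => ?_⟩
  obtain ⟨y, hy, hxy⟩ := hF x hx
  refine ((hp y).of_skorohodDist_lt (hxy.trans_le (min_le_left _ _))
    (hxy.trans_le (min_le_right _ _))).mono ?_ (ENNReal.add_thirds ε).le
  linarith [he y hy]

/-! ### Total boundedness -/

/-- The piecewise linear time change carrying one partition to another one. -/
theorem exists_timeChange_of_partitions {r : ℕ} {p p' : ℕ → I} {c : ℝ} (hc : 0 ≤ c)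
    (hp0 : p 0 = 0) (hp1 : p r = 1) (hp0' : p' 0 = 0) (hp1' : p' r = 1)
    (hp : ∀ i < r, p i < p (i + 1))
    (h : ∀ i < r, Real.exp (-c) * ((p (i + 1) : ℝ) - p i) ≤ (p' (i + 1) : ℝ) - p' i ∧
      (p' (i + 1) : ℝ) - p' i ≤ Real.exp c * ((p (i + 1) : ℝ) - p i)) :
    ∃ l : TimeChange, (∀ i ≤ r, l (p i) = p' i) ∧ logNorm l ≤ ENNReal.ofReal c := by
  have hgap : ∀ i < r, (0 : ℝ) < (p (i + 1) : ℝ) - p i := fun i hi => sub_pos.2 (hp i hi)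
  have hmono : ∀ i j, i ≤ j → j ≤ r → (p i : ℝ) ≤ p j := by
    intro i j hij
    induction j, hij using Nat.le_induction with
    | base => exact fun _ => le_rfl
    | succ j _ ih => exact fun hj => (ih (by omega)).trans (by linarith [hgap j (by omega)])
  let k : ℕ → ℝ := fun i => ((p' (i + 1) : ℝ) - p' i) / ((p (i + 1) : ℝ) - p i)
  -- `m i t` is the length of the part of `[p i, p (i + 1)]` to the left of `t`, so `g` has slope `k
  -- i` there. Increments of `g` are sums of nonnegative lengths weighted by slopes in `[e^{-c},
  -- e^c]`.
  let m : ℕ → I → ℝ := fun i t => min (t : ℝ) (p (i + 1)) - min (t : ℝ) (p i)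
  let g : I → ℝ := fun t => ∑ i ∈ Finset.range r, k i * m i t
  have hk : ∀ i < r, Real.exp (-c) ≤ k i ∧ k i ≤ Real.exp c := fun i hi =>
    ⟨(le_div_iff₀ (hgap i hi)).2 (h i hi).1, (div_le_iff₀ (hgap i hi)).2 (h i hi).2⟩
  have hm : ∀ i < r, ∀ s s' : I, s ≤ s' → 0 ≤ m i s' - m i s := by
    intro i hi s s' hs
    have h1 := hgap i hi
    have h2 : (s : ℝ) ≤ s' := hs
    simp only [m]
    rcases min_cases (s : ℝ) (p (i + 1)) with h3 | h3 <;>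
    rcases min_cases (s' : ℝ) (p (i + 1)) with h4 | h4 <;>
    rcases min_cases (s : ℝ) (p i) with h5 | h5 <;>
    rcases min_cases (s' : ℝ) (p i) with h6 | h6 <;> linarith
  have hsum : ∀ t : I, ∑ i ∈ Finset.range r, m i t = t := by
    intro t
    rw [Finset.sum_range_sub (fun i => min (t : ℝ) (p i)), hp0, hp1]
    simp [t.2.1, t.2.2]
  have hg : ∀ j ≤ r, g (p j) = p' j := by
    intro j hj
    have h1 : g (p j) = ∑ i ∈ Finset.range j, k i * m i (p j) := by
      refine (Finset.sum_subset (Finset.range_mono hj) fun i hi hi' => ?_).symm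
      rw [Finset.mem_range] at hi hi'
      have h2 := hmono j i (by omega) hi.le
      have h3 := hmono j (i + 1) (by omega) hi
      simp [m, min_eq_left h2, min_eq_left h3]
    have h2 : ∀ i ∈ Finset.range j, k i * m i (p j) = (p' (i + 1) : ℝ) - p' i := by
      intro i hi
      rw [Finset.mem_range] at hi
      have h2 := hmono i j hi.le hj
      have h3 := hmono (i + 1) j hi hj
      simp only [m, min_eq_right h2, min_eq_right h3, k]
      exact div_mul_cancel₀ _ (hgap i (by omega)).ne'
    rw [h1, Finset.sum_congr rfl h2, Finset.sum_range_sub (fun i => (p' i : ℝ)), hp0']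
    simp
  obtain ⟨l, hl, hl'⟩ := exists_timeChange_of_bilipschitz (g := g) hc
    (by have := hg 0 (Nat.zero_le r); rw [hp0, hp0'] at this; simpa using this)
    (by have := hg r le_rfl; rw [hp1, hp1'] at this; simpa using this) (by
      intro s s' hs
      have e1 : g s' - g s = ∑ i ∈ Finset.range r, k i * (m i s' - m i s) := by
        simp only [g, ← Finset.sum_sub_distrib, mul_sub]
      have e2 : (s' : ℝ) - s = ∑ i ∈ Finset.range r, (m i s' - m i s) := by
        rw [Finset.sum_sub_distrib, hsum, hsum]
      rw [e1, e2, Finset.mul_sum, Finset.mul_sum]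
      constructor <;> refine Finset.sum_le_sum fun i hi => ?_
      · exact mul_le_mul_of_nonneg_right (hk i (Finset.mem_range.1 hi)).1
          (hm i (Finset.mem_range.1 hi) s s' hs)
      · exact mul_le_mul_of_nonneg_right (hk i (Finset.mem_range.1 hi)).2
          (hm i (Finset.mem_range.1 hi) s s' hs))
  exact ⟨l, fun i hi => Subtype.ext ((hl _).trans (hg i hi)), hl'⟩

/-- Corresponding gaps differ by at most `2ηc` and are at least `η`, so their ratios are at most `1
+ 2c ≤ e^{2c}` in both directions. The time change between the partitions then allows
interval-by-interval comparison. -/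
theorem skorohodDist_le_of_partitions {x x' : Cadlag S} {r : ℕ} {p p' : ℕ → I} {η c : ℝ}
    {e e' : ℝ≥0∞} (hη : 0 < η) (hc : 0 ≤ c)
    (hp0 : p 0 = 0) (hp1 : p r = 1) (hp0' : p' 0 = 0) (hp1' : p' r = 1)
    (hp : ∀ i < r, η ≤ (p (i + 1) : ℝ) - p i ∧
      ∀ u, p i ≤ u → u < p (i + 1) → edist (x u) (x (p i)) ≤ e)
    (hp' : ∀ i < r, η ≤ (p' (i + 1) : ℝ) - p' i ∧
      ∀ u, p' i ≤ u → u < p' (i + 1) → edist (x' u) (x' (p' i)) ≤ e)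
    (hpp : ∀ i ≤ r, |(p i : ℝ) - p' i| ≤ η * c)
    (hxx : ∀ i ≤ r, edist (x (p i)) (x' (p' i)) ≤ e') :
    skorohodDist logNorm x x' ≤ max (ENNReal.ofReal (2 * c)) (e + e' + e) := by
  have hexp := Real.add_one_le_exp (2 * c)
  have hbound : ∀ a b : ℝ, η ≤ a → b ≤ a + 2 * (η * c) → b ≤ Real.exp (2 * c) * a := by
    intro a b ha hb
    have h1 : (2 * c + 1) * a ≤ Real.exp (2 * c) * a :=
      mul_le_mul_of_nonneg_right hexp (hη.le.trans ha)
    have h2 := mul_le_mul_of_nonneg_right ha hc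
    linarith
  obtain ⟨l, hl, hl'⟩ := exists_timeChange_of_partitions (c := 2 * c) (by positivity)
    hp0 hp1 hp0' hp1' (fun i hi => Subtype.coe_lt_coe.1 (by linarith [(hp i hi).1])) (by
      intro i hi
      have h1 := abs_le.1 (hpp i hi.le)
      have h2 := abs_le.1 (hpp (i + 1) hi)
      refine ⟨?_, hbound _ _ (hp i hi).1 (by linarith)⟩
      rw [Real.exp_neg, inv_mul_le_iff₀ (Real.exp_pos _)]
      exact hbound _ _ (hp' i hi).1 (by linarith))
  refine iInf_le_of_le l (max_le_max hl' (iSup_le fun t => ?_))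
  rcases (show t ≤ 1 from t.2.2).eq_or_lt with rfl | ht
  · have := hxx r le_rfl
    rw [hp1, hp1'] at this
    rw [show l 1 = 1 from l.map_top]
    exact this.trans (le_add_self.trans le_self_add)
  · obtain ⟨i, hi, hi1, hi2⟩ := exists_partition_index hp0 hp1 ht
    refine (edist_triangle4 _ (x (p i)) (x' (p' i)) _).trans
      (add_le_add (add_le_add ((hp i hi).2 t hi1 hi2) (hxx i hi.le)) ?_)
    rw [edist_comm]
    refine (hp' i hi).2 _ ?_ ?_
    · rw [← hl i hi.le]; exact l.le_iff_le.2 hi1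
    · rw [← hl (i + 1) hi]; exact l.lt_iff_lt.2 hi2

theorem totallyBounded_of_finite_key.{u} {X : Type u} [PseudoEMetricSpace X] {A : Set X}
    (h : ∀ ε : ℝ≥0∞, 0 < ε → ∃ (κ : Type u) (_ : Finite κ) (key : A → κ),
      ∀ x y : A, key x = key y → edist (x : X) y < ε) : TotallyBounded A := by
  refine EMetric.totallyBounded_iff.2 fun ε hε => ?_
  obtain ⟨κ, _, key, hkey⟩ := h ε hε
  have hex : ∀ k : range key, ∃ x, key x = k := fun k => k.2
  choose f hf using hex
  refine ⟨range fun k => (f k : X), finite_range _, fun x hx => ?_⟩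
  exact mem_biUnion ⟨⟨key ⟨x, hx⟩, ⟨x, hx⟩, rfl⟩, rfl⟩
    (hkey ⟨x, hx⟩ _ (hf ⟨key ⟨x, hx⟩, ⟨x, hx⟩, rfl⟩).symm)

theorem natCast_mul_le_of_gaps {η : ℝ} {r : ℕ} {p : ℕ → I}
    (hp : ∀ i < r, η ≤ (p (i + 1) : ℝ) - p i) : r * η ≤ (p r : ℝ) := by
  induction r with
  | zero => simpa using (p 0).2.1
  | succ r ih =>
    have h1 := ih fun i hi => hp i (by omega)
    have h2 := hp r (by omega)
    push_cast
    linarith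

theorem abs_sub_lt_one_of_natFloor_eq {a b : ℝ} (ha : 0 ≤ a) (hb : 0 ≤ b) (h : ⌊a⌋₊ = ⌊b⌋₊) :
    |a - b| < 1 := by
  have h1 := Nat.floor_le ha
  have h2 := Nat.floor_le hb
  have h3 := Nat.lt_floor_add_one a
  have h4 := Nat.lt_floor_add_one b
  rw [h] at h1 h3
  exact abs_lt.2 ⟨by linarith, by linarith⟩

/-- A family of càdlàg functions with a totally bounded set of values and uniform partitions is
totally bounded. -/
theorem totallyBounded_logCadlag {A : Set (LogCadlag S)} (hA : TotallyBounded (valueSet A))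
    (hp : ∀ ε : ℝ≥0∞, 0 < ε → ∃ η : ℝ, 0 < η ∧ ∀ x ∈ A, HasPartition x η ε) :
    TotallyBounded A := by
  refine totallyBounded_of_finite_key fun ε hε => ?_
  obtain ⟨ε', hε'0, hε'⟩ := ENNReal.lt_iff_exists_nnreal_btwn.1 hε
  have hε'R : (0 : ℝ) < ε' := by exact_mod_cast hε'0
  -- Four errors add up: one oscillation for each function, and the distance of each of the two
  -- values to a common net point.
  let e : ℝ≥0∞ := ε' / 2 / 2
  have he0 : 0 < e :=
    ENNReal.div_pos (ENNReal.div_pos hε'0.ne' (by norm_num)).ne' (by norm_num)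
  have he4 : e + (e + e) + e = ε' := by
    have : e + (e + e) + e = (e + e) + (e + e) := by ring
    rw [this, ENNReal.add_halves, ENNReal.add_halves]
  obtain ⟨η, hη, hpart⟩ := hp e he0
  have hex : ∀ x : A, ∃ (r : ℕ) (p : ℕ → I), p 0 = 0 ∧ p r = 1 ∧
      ∀ i < r, η ≤ (p (i + 1) : ℝ) - p i ∧
        ∀ u, p i ≤ u → u < p (i + 1) →
          edist (Cadlag.toFun (x : LogCadlag S) u) (Cadlag.toFun (x : LogCadlag S) (p i)) ≤ e :=
    fun x => hpart x x.2
  choose r p hp0 hp1 hpi using hex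
  obtain ⟨M, hM⟩ := exists_nat_ge (1 / η)
  have hrM : ∀ x, r x ≤ M := by
    intro x
    have h1 := natCast_mul_le_of_gaps (p := p x) fun i hi => (hpi x i hi).1
    rw [hp1 x, Set.Icc.coe_one, ← le_div_iff₀ hη] at h1
    exact_mod_cast h1.trans hM
  obtain ⟨F, hF, hAF⟩ := EMetric.totallyBounded_iff.1 hA e he0
  have hex : ∀ (x : A) (i : ℕ), ∃ w : F,
      edist (Cadlag.toFun (x : LogCadlag S) (p x i)) (w : S) < e := by
    intro x i
    obtain ⟨w, hw, hw'⟩ := mem_iUnion₂.1 (hAF (mem_biUnion x.2 ⟨p x i, rfl⟩))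
    exact ⟨⟨w, hw⟩, hw'⟩
  choose w hw using hex
  have hηc : 0 < η * (ε' / 2) := by positivity
  -- A grid of mesh `1 / G ≤ η * (ε' / 2)` allows `c = ε' / 2`, hence a time change of logarithmic
  -- size at most `ε'`.
  obtain ⟨G, hG⟩ := exists_nat_ge (1 / (η * (ε' / 2)))
  have hG0 : (0 : ℝ) < G := (by positivity : 0 < 1 / (η * ((ε' : ℝ) / 2))).trans_le hG
  have hfloor : ∀ t : I, ⌊(t : ℝ) * G⌋₊ < G + 1 := fun t => by
    refine Nat.lt_succ_of_le (Nat.floor_le_of_le ?_)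
    exact mul_le_of_le_one_left hG0.le t.2.2
  have : Finite F := hF
  -- The key records the number of intervals, the grid cell of each partition point and a net point
  -- near each value; entries beyond index `r x` are never used.
  refine ⟨Fin (M + 1) × (Fin (M + 1) → Fin (G + 1)) × (Fin (M + 1) → F), inferInstance,
    fun x => ⟨⟨r x, Nat.lt_succ_of_le (hrM x)⟩, fun i => ⟨⌊(p x i : ℝ) * G⌋₊, hfloor _⟩,
      fun i => w x i⟩, fun x y hxy => ?_⟩
  simp only [Prod.mk.injEq, Fin.mk.injEq, funext_iff] at hxy
  obtain ⟨hr, hgrid, hnet⟩ := hxy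
  have hlt : ∀ i ≤ r x, i < M + 1 := fun i hi => Nat.lt_succ_of_le (hi.trans (hrM x))
  refine lt_of_le_of_lt (skorohodDist_le_of_partitions (p := p x) (p' := p y) (r := r x) (e := e)
    (e' := e + e) hη (half_pos hε'R).le (hp0 x) (hp1 x) (hp0 y) (hr ▸ hp1 y) (hpi x)
    (hr ▸ hpi y) (fun i hi => ?_) (fun i hi => ?_)) (max_lt ?_ (he4.trans_lt hε'))
  · have h1 := abs_sub_lt_one_of_natFloor_eq (mul_nonneg (p x i).2.1 hG0.le)
      (mul_nonneg (p y i).2.1 hG0.le) (hgrid ⟨i, hlt i hi⟩)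
    rw [← sub_mul, abs_mul, abs_of_pos hG0, ← lt_div_iff₀ hG0] at h1
    exact h1.le.trans ((one_div_le hηc hG0).1 hG)
  · refine (edist_triangle_right _ _ (w x i : S)).trans (add_le_add (hw x i).le ?_)
    have h2 : w x i = w y i := hnet ⟨i, hlt i hi⟩
    rw [h2]
    exact (hw y i).le
  · rw [mul_div_cancel₀ _ two_ne_zero, ENNReal.ofReal_coe_nnreal]
    exact hε'

end Modulus

/-! ### Relative compactness -/

theorem hasFiniteSubcovers_of_isCompact_closure_dd {A : Set DD} (hA : IsCompact (closure A)) :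
    HasFiniteSubcovers A := by
  intro r hr
  obtain ⟨F, -, hF⟩ := hA.elim_nhds_subcover (fun y => Metric.eball y (r y))
    fun y _ => Metric.eball_mem_nhds y (hr y)
  refine ⟨F, fun x hx => ?_⟩
  obtain ⟨y, hy, hxy⟩ := mem_iUnion₂.1 (hF (subset_closure hx))
  exact ⟨y, hy, hxy⟩

/-- The balls of `D` are logarithmic, whereas the covers are measured by `supDev`. Passing from one
to the other costs a factor `2` for radii at most `1`, whence `min 1 (r y / 2)`. -/
theorem hasFiniteSubcovers_of_isCompact_closure_d {A : Set D} (hA : IsCompact (closure A)) :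
    HasFiniteSubcovers A := by
  intro r hr
  obtain ⟨F, -, hF⟩ := hA.elim_nhds_subcover (fun y => Metric.eball y (min 1 (r y / 2)))
    fun y _ => Metric.eball_mem_nhds y
      (lt_min one_pos (ENNReal.div_pos (hr y).ne' (by norm_num)))
  refine ⟨F, fun x hx => ?_⟩
  obtain ⟨y, hy, hxy⟩ := mem_iUnion₂.1 (hF (subset_closure hx))
  refine ⟨y, hy, (skorohodDist_supDev_le (min_le_left _ _) hxy).trans_le ?_⟩
  calc 2 * min 1 (r y / 2) ≤ 2 * (r y / 2) := by gcongr; exact min_le_right _ _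
    _ = r y := ENNReal.mul_div_cancel two_ne_zero ENNReal.ofNat_ne_top

theorem isCompact_closure_dd_of_totallyBounded {A : Set DD}
    (hA : TotallyBounded (α := LogCadlag D) A) : IsCompact (closure A) := by
  have h : IsCompact (closure (X := LogCadlag D) A) :=
    hA.closure.isCompact_of_isClosed isClosed_closure
  have h' : IsCompact (X := DD) (image (β := DD) (fun x => x) (closure (X := LogCadlag D) A)) :=
    h.image continuous_logCadlag_id
  exact h'.closure_of_subset fun x hx => ⟨x, subset_closure (X := LogCadlag D) hx, rfl⟩

theorem iSup_superNorm_eq (A : Set DD) :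
    ⨆ x ∈ A, superNorm x = ⨆ a ∈ valueSet (valueSet A), ‖a‖ₑ := by
  simp only [valueSet, superNorm, iSup_iUnion, iSup_range]

theorem totallyBounded_real_iff {B : Set ℝ} : TotallyBounded B ↔ ⨆ a ∈ B, ‖a‖ₑ < ∞ := by
  constructor
  · intro h
    obtain ⟨C, hC⟩ := h.isBounded.exists_norm_le
    refine (iSup₂_le fun a ha => ?_).trans_lt (ENNReal.ofReal_lt_top (r := C))
    rw [← ofReal_norm]
    exact ENNReal.ofReal_le_ofReal (hC a ha)
  · intro h
    have hB : Bornology.IsBounded B :=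
      isBounded_iff_forall_norm_le.2 ⟨(⨆ a ∈ B, ‖a‖ₑ).toReal, fun a ha => ?_⟩
    · exact Metric.isCompact_of_isClosed_isBounded isClosed_closure hB.closure
        |>.totallyBounded.subset subset_closure
    rw [← toReal_enorm]
    exact ENNReal.toReal_mono h.ne (le_iSup₂_of_le a ha le_rfl)

/-- Relative compactness in `D([0,1];D)` in terms of values and partitions. -/
theorem isCompact_closure_dd_iff {A : Set DD} :
    IsCompact (closure A) ↔ TotallyBounded (valueSet (valueSet A)) ∧
      (∀ ε : ℝ≥0∞, 0 < ε → ∃ η : ℝ, 0 < η ∧ ∀ z ∈ valueSet A, HasPartition z η ε) ∧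
      (∀ ε : ℝ≥0∞, 0 < ε → ∃ η : ℝ, 0 < η ∧ ∀ x ∈ A, HasPartition x η ε) := by
  constructor
  · intro h
    have hA := hasFiniteSubcovers_of_isCompact_closure_dd h
    -- Completeness of `D` for the logarithmic distance turns total boundedness of the values into
    -- compactness, so necessity can be applied again inside `D`.
    have hB : IsCompact (closure (valueSet A)) :=
      hA.totallyBounded_valueSet.closure.isCompact_of_isClosed isClosed_closure
    have hB' := hasFiniteSubcovers_of_isCompact_closure_d hB
    exact ⟨hB'.totallyBounded_valueSet, hB'.uniform_partition, hA.uniform_partition⟩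
  · rintro ⟨h1, h2, h3⟩
    have hB : TotallyBounded (valueSet A) :=
      totallyBounded_logCadlag (S := ℝ) (A := valueSet A) h1 h2
    exact isCompact_closure_dd_of_totallyBounded (totallyBounded_logCadlag hB h3)

end Skorohod

theorem mainTheorem4 (A : Set Skorohod.DD) :
    IsCompact (closure A) ↔
      -- (i)
      (⨆ x ∈ A, Skorohod.superNorm x) < ∞ ∧
      -- (ii')
      (Tendsto (fun δ : I => ⨆ x ∈ A, ⨆ t : I, Skorohod.wSecond (x t) δ) (𝓝[>] 0) (𝓝 0) ∧
        Tendsto (fun δ : I => ⨆ x ∈ A, ⨆ t : I, edist (x t δ) (x t 0)) (𝓝[>] 0) (𝓝 0) ∧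
        Tendsto (fun δ : I => ⨆ x ∈ A, ⨆ t : I, edist (Function.leftLim (x t) 1) (x t (σ δ)))
          (𝓝[>] 0) (𝓝 0)) ∧
      -- (iii')
      (Tendsto (fun δ : I => ⨆ x ∈ A, Skorohod.wSecond x δ) (𝓝[>] 0) (𝓝 0) ∧
        Tendsto (fun δ : I => ⨆ x ∈ A, edist (x δ) (x 0)) (𝓝[>] 0) (𝓝 0) ∧
        Tendsto (fun δ : I => ⨆ x ∈ A, edist (Function.leftLim x 1) (x (σ δ)))
          (𝓝[>] 0) (𝓝 0)) := by
  -- `uniform_partition_iff` is used for `valueSet A` to get (ii') and for `A` to get (iii');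
  -- suprema over `valueSet A` then unfold into suprema over `x ∈ A` and `t`.
  rw [Skorohod.isCompact_closure_dd_iff, Skorohod.totallyBounded_real_iff,
    ← Skorohod.iSup_superNorm_eq, Skorohod.uniform_partition_iff, Skorohod.uniform_partition_iff]
  simp only [Skorohod.valueSet, iSup_iUnion, iSup_range]
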